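/- **Setting.** Graphs are partially directed graphs on the vertex set $V=\{1,\dots,n\}$ without self-edges. For such a graph, $x\to y$ denotes a directed and $x-y$ an undirected edge; $x,y$ are adjacent if joined by an edge of any type, and neighbours if $x-y$. A v-structure is $x\to y\leftarrow z$ with $x\neq z$ not adjacent. Two directed acyclic graphs (DAGs) on $V$ are Markov equivalent if they have the same adjacencies and the same v-structures; $\mathcal M_n$ is the finite set of Markov equivalence classes (MECs). A class $\gamma$ is represented by its CPDAG, which has $x\to y$ if every member of $\gamma$ has $x\to y$, and $x-y$ if some member has $x\to y$ and some member has $y\to x$. The completion of a graph is the MEC of the DAGs with the same adjacencies and v-structures, if there are any. For $x\ne y$ not adjacent in the CPDAG of $\gamma$ and a set $T$ of neighbours of $y$ that are not adjacent to $x$, $\operatorname{Insert}(\gamma,x,y,T)$ is the completion (if it exists) of the graph obtained from the CPDAG of $\gamma$ by adding $x\to y$ and directing $t-y$ as $t\to y$ for all $t\in T$. If the CPDAG of $\gamma$ has $x-y$ or $x\to y$, and $H$ is a set of neighbours of $y$ that are adjacent to $x$, $\operatorname{Delete}(\gamma,x,y,H)$ is the completion (if it exists) of the graph obtained by removing the edge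 between $x$ and $y$ and directing the undirected ones among the edges $x-h$, $y-h$ as $x\to h$, $y\to h$ for all $h\in H$. A move from $\gamma$ to $\gamma'$ is local if some DAG in $\gamma$ can be turned into a DAG in $\gamma'$ by inserting or deleting a single edge. $\operatorname{Insert}(\gamma)$ (resp. $\operatorname{Delete}(\gamma)$) is the set of all $\gamma'$ that are obtained from $\gamma$ by some Insert (resp. Delete) operation whose result is defined and for which the move from $\gamma$ to $\gamma'$ is local. Let $\pi$ be a probability distribution on $\mathcal M_n$ with $\pi\{\gamma\}>0$ for all $\gamma$, and let $g$ satisfy $g(t)>0$ and $g(t)=t\,g(1/t)$ for all $t>0$. The Zanella process $Z=(Z_t)_{t\ge0}$ is the time-homogeneous Markov jump process on $\mathcal M_n$ with intensities $$\lambda(\gamma\curvearrowright\eta)=\begin{cases} g\!\left(\dfrac{\pi\{\eta\}}{\pi\{\gamma\}}\right)&\text{if }\eta\in\operatorname{Insert}(\gamma)\cup\operatorname{Delete}(\gamma),\\ 0&\text{otherwise,}\end{cases}$$ that is, its paths are almost surely right-continuous and constant apart from isolated jumps, and it has the Markov property with transition probabilities $p_t(a,b)$, $t\ge 0$, which form stochastic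 matrices with $p_0=\mathrm{id}$ and $p_{s+t}=p_sp_t$, and satisfy $p_h(a,b)=\lambda(a\curvearrowright b)\,h+o(h)$ as $h\downarrow0$ for $a\ne b$. **Theorem.** There is exactly one family $(p_t)_{t\ge0}$ of transition probabilities with the intensities $\lambda$, and it satisfies: 1. (irreducibility) $p_t(\eta,\gamma)>0$ for all $t>0$ and all $\eta,\gamma\in\mathcal M_n$; 2. (reversibility) $\pi\{\eta\}\,p_t(\eta,\gamma)=\pi\{\gamma\}\,p_t(\gamma,\eta)$ for all $t\ge 0$ and all $\eta,\gamma\in\mathcal M_n$; 3. $\pi$ is the unique stationary distribution: a probability distribution $\nu$ on $\mathcal M_n$ satisfies $\sum_a\nu\{a\}p_t(a,b)=\nu\{b\}$ for all $t\ge0$ and $b$ if and only if $\nu=\pi$; 4. $\lim_{t\to\infty}p_t(\eta,\gamma)=\pi\{\gamma\}$ for all $\eta,\gamma\in\mathcal M_n$. Consequently, for every Zanella process $Z$ (on any probability space, with any initial distribution): whenever $P(Z_s=\eta)>0$, one has $P(Z_t=\gamma\mid Z_s=\eta)>0$ for all $t>s$ and $\gamma$, and $\lim_{t\to\infty}P(Z_t=\gamma\mid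 Z_s=\eta)=\pi\{\gamma\}$ for all $\gamma$; and the law of $Z_t$ does not depend on $t$ if and only if $Z_0\sim\pi$. -/

import Mathlib

open Filter Topology MeasureTheory ProbabilityTheory
open scoped NNReal

/-- A partially directed graph on the vertex set `Fin n`: a set of ordered pairs without
self-edges. -/
@[ext]
structure PDGraph (n : ℕ) where
  E : Fin n → Fin n → Prop
  loopless : ∀ x, ¬ E x x

namespace PDGraph

variable {n : ℕ}

/-- The edge `x → y`. -/
def Directed (G : PDGraph n) (x y : Fin n) : Prop := G.E x y ∧ ¬ G.E y x

/-- The edge `x - y`; then `x` and `y` are called neighbours. -/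
def Undirected (G : PDGraph n) (x y : Fin n) : Prop := G.E x y ∧ G.E y x

/-- `x` and `y` are joined by an edge of any type. -/
def Adj (G : PDGraph n) (x y : Fin n) : Prop := G.E x y ∨ G.E y x

/-- The v-structure `x → y ← z`. -/
def VStructure (G : PDGraph n) (x y z : Fin n) : Prop :=
  x ≠ z ∧ G.Directed x y ∧ G.Directed z y ∧ ¬ G.Adj x z

/-- The same adjacencies and the same v-structures. -/
def SameSkeletonVStructures (G H : PDGraph n) : Prop :=
  (∀ x y, G.Adj x y ↔ H.Adj x y) ∧ ∀ x y z, G.VStructure x y z ↔ H.VStructure x y z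

/-- Directed acyclic graphs: no undirected edge and no directed cycle. -/
def IsDAG (G : PDGraph n) : Prop :=
  (∀ x y, ¬ G.Undirected x y) ∧ ∀ x, ¬ Relation.TransGen G.Directed x x

/-- `G'` arises from `G` by inserting one edge `x → y` between non-adjacent vertices. -/
def IsEdgeInsertion (G G' : PDGraph n) : Prop :=
  ∃ x y, x ≠ y ∧ ¬ G.Adj x y ∧ ∀ a b, G'.E a b ↔ G.E a b ∨ (a = x ∧ b = y)

/-- Insert `x → y` and direct the undirected edges `t - y`, `t ∈ T`, as `t → y`. -/
def insertEdge (G : PDGraph n) (x y : Fin n) (T : Set (Fin n)) : PDGraph n where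
  E a b := a ≠ b ∧ ((a = x ∧ b = y) ∨ (G.E a b ∧ ¬ (a = y ∧ b ∈ T ∧ G.E b a)))
  loopless := fun _ h => h.1 rfl

/-- Delete the edge between `x` and `y` and direct the undirected edges `x - h`, `y - h`, `h ∈ H`,
as `x → h`, `y → h`. -/
def deleteEdge (G : PDGraph n) (x y : Fin n) (H : Set (Fin n)) : PDGraph n where
  E a b := G.E a b ∧ ¬ ((a = x ∧ b = y) ∨ (a = y ∧ b = x)) ∧
    ¬ (a ∈ H ∧ (b = x ∨ b = y) ∧ G.E b a)
  loopless := fun a h => G.loopless a h.1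

theorem sameSkeletonVStructures_equivalence :
    Equivalence (SameSkeletonVStructures (n := n)) where
  refl _ := ⟨fun _ _ => Iff.rfl, fun _ _ _ => Iff.rfl⟩
  symm h := ⟨fun x y => (h.1 x y).symm, fun x y z => (h.2 x y z).symm⟩
  trans h k := ⟨fun x y => (h.1 x y).trans (k.1 x y), fun x y z => (h.2 x y z).trans (k.2 x y z)⟩

end PDGraph

/-- The space of DAGs on `n` vertices. -/
def DAG (n : ℕ) : Type := {G : PDGraph n // G.IsDAG}

/-- Markov equivalence of DAGs: the same adjacencies and the same v-structures. -/
instance DAG.markovEquivalence (n : ℕ) : Setoid (DAG n) where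
  r G H := G.1.SameSkeletonVStructures H.1
  iseqv :=
    ⟨fun G => PDGraph.sameSkeletonVStructures_equivalence.refl G.1,
      fun h => PDGraph.sameSkeletonVStructures_equivalence.symm h,
      fun h k => PDGraph.sameSkeletonVStructures_equivalence.trans h k⟩

/-- The space of Markov equivalence classes of DAGs on `n` vertices. -/
def MEC (n : ℕ) : Type := Quotient (DAG.markovEquivalence n)

instance MEC.instFinite (n : ℕ) : Finite (MEC n) := by
  have h : Finite (PDGraph n) :=
    Finite.of_injective (fun G : PDGraph n => G.E) (fun _ _ h => PDGraph.ext h)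
  have h' : Finite (DAG n) := Subtype.finite
  exact Quotient.finite _

noncomputable instance MEC.instFintype (n : ℕ) : Fintype (MEC n) := Fintype.ofFinite _

namespace MEC

variable {n : ℕ}

/-- `γ.Mem G`: the DAG `G` is a member of the class `γ`. -/
def Mem (γ : MEC n) (G : DAG n) : Prop := (Quotient.mk _ G : MEC n) = γ

/-- The CPDAG of the class `γ`. By `cpdag_directed` and `cpdag_undirected`, it has `x → y` if every
member of `γ` has `x → y`, and `x - y` if some member has `x → y` and some member has `y → x`. -/
def cpdag (γ : MEC n) : PDGraph n where
  E x y := ∃ G : DAG n, γ.Mem G ∧ G.1.Directed x y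
  loopless := fun _ ⟨_, _, h⟩ => h.2 h.1

theorem cpdag_undirected (γ : MEC n) (x y : Fin n) :
    γ.cpdag.Undirected x y ↔
      (∃ G, γ.Mem G ∧ G.1.Directed x y) ∧ ∃ G, γ.Mem G ∧ G.1.Directed y x :=
  Iff.rfl

theorem cpdag_directed (γ : MEC n) (x y : Fin n) :
    γ.cpdag.Directed x y ↔ ∀ G, γ.Mem G → G.1.Directed x y := by
  constructor
  · rintro ⟨⟨G, hG, hxy⟩, hno⟩ G' hG'
    have hrel : G.1.SameSkeletonVStructures G'.1 := Quotient.exact (hG.trans hG'.symm)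
    have hnot : ¬ G'.1.Directed y x := fun h => hno ⟨G', hG', h⟩
    have hund := G'.2.1
    rcases (hrel.1 x y).1 (Or.inl hxy.1) with h | h
    · exact ⟨h, fun h' => hund x y ⟨h, h'⟩⟩
    · exact absurd ⟨h, fun h' => hund x y ⟨h', h⟩⟩ hnot
  · intro h
    obtain ⟨G, hG⟩ := Quotient.exists_rep γ
    have hd := h G hG
    exact ⟨⟨G, hG, hd⟩, fun ⟨G', hG', h'⟩ => h'.2 (h G' hG').1⟩

/-- `γ` is the completion of the graph `P`: the members of `γ` have the skeleton and the
v-structures of `P`. (A graph `P` has at most one completion, and possibly none.) -/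
def IsCompletion (P : PDGraph n) (γ : MEC n) : Prop :=
  ∀ G, γ.Mem G → G.1.SameSkeletonVStructures P

/-- The move from `γ` to `γ'` is local: some member of `γ` becomes a member of `γ'` by a single
edge insertion or a single edge deletion. -/
def IsLocalMove (γ γ' : MEC n) : Prop :=
  ∃ G G' : DAG n, γ.Mem G ∧ γ'.Mem G' ∧ (G.1.IsEdgeInsertion G'.1 ∨ G'.1.IsEdgeInsertion G.1)

/-- `Insert(γ, x, y, T)` is defined and equal to `γ'`: `x` and `y` are distinct and not adjacent,
`T` consists of neighbours of `y` that are not adjacent to `x`, and inserting `x → y` and directing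
`t → y` for `t ∈ T` gives a graph with completion `γ'`. -/
def InsertsTo (γ : MEC n) (x y : Fin n) (T : Set (Fin n)) (γ' : MEC n) : Prop :=
  x ≠ y ∧ ¬ γ.cpdag.Adj x y ∧ (∀ t ∈ T, γ.cpdag.Undirected t y ∧ ¬ γ.cpdag.Adj t x) ∧
    IsCompletion (γ.cpdag.insertEdge x y T) γ'

/-- `Delete(γ, x, y, H)` is defined and equal to `γ'`: `γ` has the edge `x - y` or `x → y`,
`H` consists of neighbours of `y` that are adjacent to `x`, and deleting the edge and directing
`x - h`, `y - h` as `x → h`, `y → h` for `h ∈ H` gives a graph with completion `γ'`. -/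
def DeletesTo (γ : MEC n) (x y : Fin n) (H : Set (Fin n)) (γ' : MEC n) : Prop :=
  (γ.cpdag.Undirected x y ∨ γ.cpdag.Directed x y) ∧
    (∀ h ∈ H, γ.cpdag.Undirected h y ∧ γ.cpdag.Adj h x) ∧
    IsCompletion (γ.cpdag.deleteEdge x y H) γ'

/-- The set `Insert(γ)` of classes obtained from `γ` by a valid local Insert operation. -/
def insertSet (γ : MEC n) : Set (MEC n) :=
  {γ' | ∃ x y T, γ.InsertsTo x y T γ' ∧ IsLocalMove γ γ'}

/-- The set `Delete(γ)` of classes obtained from `γ` by a valid local Delete operation. -/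
def deleteSet (γ : MEC n) : Set (MEC n) :=
  {γ' | ∃ x y H, γ.DeletesTo x y H γ' ∧ IsLocalMove γ γ'}

open Classical in
/-- The jump intensity of the Zanella process with balancing function `g` and target `π`. -/
noncomputable def zanellaRate (g : ℝ → ℝ) (π : MEC n → ℝ) (γ η : MEC n) : ℝ :=
  if η ∈ γ.insertSet ∪ γ.deleteSet then g (π η / π γ) else 0

end MEC

section JumpProcess

variable {S : Type*} [Fintype S]

/-- `p t a b = P(Z_{s+t} = b | Z_s = a)` are the transition probabilities of a time-homogeneous
Markov jump process on the finite set `S` with jump intensities `lam a b`, `a ≠ b`: stochastic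
matrices with `p 0` the identity and the Chapman-Kolmogorov property, such that
`p h a b = lam a b * h + o(h)` as `h ↓ 0` for `a ≠ b`. -/
structure IsTransitionFunction (lam : S → S → ℝ) (p : ℝ≥0 → S → S → ℝ) : Prop where
  nonneg : ∀ t a b, 0 ≤ p t a b
  sum_eq_one : ∀ t a, ∑ b, p t a b = 1
  zero_self : ∀ a, p 0 a a = 1
  zero_ne : ∀ a b, a ≠ b → p 0 a b = 0
  chapman_kolmogorov : ∀ s t a b, p (s + t) a b = ∑ c, p s a c * p t c b
  intensity : ∀ a b, a ≠ b →
    Tendsto (fun h : ℝ≥0 => p h a b / (h : ℝ)) (𝓝[>] 0) (𝓝 (lam a b))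

/-- The distribution `ν` is stationary for the transition probabilities `p`. -/
def IsStationaryFor (p : ℝ≥0 → S → S → ℝ) (ν : S → ℝ) : Prop :=
  ∀ t b, ∑ a, ν a * p t a b = ν b

/-- `Z` is a time-homogeneous Markov jump process on the finite set `S` with jump intensities
`lam`: almost surely its paths are right-continuous and constant apart from isolated jumps, and it
has the Markov property with transition probabilities that have the intensities `lam`. -/
structure IsMarkovJumpProcess {Ω : Type*} [MeasurableSpace Ω] (lam : S → S → ℝ)
    (μ : Measure Ω) (Z : ℝ≥0 → Ω → S) : Prop where
  measurable : ∀ t a, MeasurableSet {ω | Z t ω = a}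
  paths : ∀ᵐ ω ∂μ, ∀ t,
    (∀ᶠ u in 𝓝[>] t, Z u ω = Z t ω) ∧ ∃ a, ∀ᶠ u in 𝓝[<] t, Z u ω = a
  markov : ∃ p, IsTransitionFunction lam p ∧
    ∀ (s t : ℝ≥0), s ≤ t → ∀ (F : Finset ℝ≥0), (∀ u ∈ F, u < s) → ∀ (x : ℝ≥0 → S) (a b : S),
      μ ({ω | Z s ω = a} ∩ {ω | ∀ u ∈ F, Z u ω = x u}) ≠ 0 →
      (μ[|{ω | Z s ω = a} ∩ {ω | ∀ u ∈ F, Z u ω = x u}]).real {ω | Z t ω = b} = p (t - s) a b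

end JumpProcess

/-! The classes in `insertSet ∪ deleteSet` are exactly those reached by a local move
(`mem_insertSet_union_deleteSet`). Local moves are symmetric, and deleting edges one at a time links
every class to the edgeless one, so the rates are positive along a connected symmetric graph; the
identity `g t = t * g (1 / t)` is detailed balance for `π`. The rest is finite Markov chain theory.
Uniformisation and a matrix exponential give a reversible transition function, a telescoping
estimate gives uniqueness, and a Doeblin contraction gives convergence and the uniqueness of `π`.

The combinatorial core is that removing `x → y` from a member of a class is always matched by a
Delete operation. The removal can create v-structures `x → b ← y`, and the operator must direct both
edges. The delicate case is a compelled `y → b`: then `x → b` must be compelled as well, which rests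
on `cpdag_no_triangle`. That lemma is proved by gluing two members along an ancestral set (`splice`)
and reversing a covered edge (`reverse`), contradicting compelledness. -/

namespace PDGraph

/-! ### Acyclicity, splicing of DAGs and reversal of covered edges. -/

variable {n : ℕ} {G G' : PDGraph n} {x y z : Fin n}

theorem IsDAG.asymm (h : G.IsDAG) (hxy : G.E x y) : ¬ G.E y x := fun hyx => h.1 x y ⟨hxy, hyx⟩

theorem IsDAG.directed_iff (h : G.IsDAG) : G.Directed x y ↔ G.E x y :=
  ⟨fun h => h.1, fun hxy => ⟨hxy, h.asymm hxy⟩⟩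

theorem IsDAG.transGen_irrefl (h : G.IsDAG) (x : Fin n) : ¬ Relation.TransGen G.E x x :=
  fun hx => h.2 x (Relation.TransGen.mono (fun _ _ hab => h.directed_iff.2 hab) x x hx)

theorem IsDAG.wellFounded (h : G.IsDAG) : WellFounded G.E := by
  have : Std.Irrefl (Relation.TransGen G.E) := ⟨h.transGen_irrefl⟩
  exact Subrelation.wf (fun hab => Relation.TransGen.single hab)
    (Finite.wellFounded_of_trans_of_irrefl (Relation.TransGen G.E))

theorem IsDAG.wellFounded_swap (h : G.IsDAG) : WellFounded (Function.swap G.E) := by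
  have : Std.Irrefl (Function.swap (Relation.TransGen G.E)) := ⟨h.transGen_irrefl⟩
  have : IsTrans _ (Function.swap (Relation.TransGen G.E)) := ⟨fun _ _ _ hab hbc => hbc.trans hab⟩
  exact Subrelation.wf (fun {_ _} hab => .single hab)
    (Finite.wellFounded_of_trans_of_irrefl (Function.swap (Relation.TransGen G.E)))

theorem isDAG_of_wellFounded (h : WellFounded G.E) : G.IsDAG := by
  refine ⟨fun x y hxy => h.asymmetric _ _ hxy.1 hxy.2, fun x hx => ?_⟩
  exact h.transGen.irrefl.irrefl x (Relation.TransGen.mono (fun _ _ hab => hab.1) x x hx)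

theorem isDAG_of_exists_source
    (h : ∀ A : Set (Fin n), A.Nonempty → ∃ a ∈ A, ∀ b ∈ A, ¬ G.E b a) : G.IsDAG :=
  isDAG_of_wellFounded (WellFounded.wellFounded_iff_has_min.2 h)

theorem IsDAG.exists_source (h : G.IsDAG) {A : Set (Fin n)} (hA : A.Nonempty) :
    ∃ a ∈ A, ∀ b ∈ A, ¬ G.E b a :=
  WellFounded.wellFounded_iff_has_min.1 h.wellFounded A hA

theorem IsDAG.exists_sink (h : G.IsDAG) {A : Set (Fin n)} (hA : A.Nonempty) :
    ∃ a ∈ A, ∀ b ∈ A, ¬ G.E a b :=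
  WellFounded.wellFounded_iff_has_min.1 h.wellFounded_swap A hA

theorem IsDAG.mono (h : G.IsDAG) (hG : ∀ a b, G'.E a b → G.E a b) : G'.IsDAG :=
  isDAG_of_wellFounded (Subrelation.wf (fun {a b} hab => hG a b hab) h.wellFounded)

theorem Adj.symm (h : G.Adj x y) : G.Adj y x := Or.symm h

theorem VStructure.symm (h : G.VStructure x y z) : G.VStructure z y x :=
  ⟨h.1.symm, h.2.2.1, h.2.1, fun k => h.2.2.2 k.symm⟩

/-- Only the edges taking part in v-structures of `G` have to be directed in `G'`; all other edges
of `G` may stay undirected there. This is how a DAG is compared with the output of an operator. -/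
theorem SameSkeletonVStructures.of_directed (hadj : ∀ x y, G.Adj x y ↔ G'.Adj x y)
    (hdir : ∀ x y, G'.Directed x y → G.Directed x y)
    (hv : ∀ x y z, G.VStructure x y z → G'.Directed x y) : G.SameSkeletonVStructures G' := by
  refine ⟨hadj, fun x y z => ⟨fun h => ?_, fun h => ?_⟩⟩
  · exact ⟨h.1, hv _ _ _ h, hv _ _ _ h.symm, fun k => h.2.2.2 ((hadj _ _).2 k)⟩
  · exact ⟨h.1, hdir _ _ h.2.1, hdir _ _ h.2.2.1, fun k => h.2.2.2 ((hadj _ _).1 k)⟩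

/-- The edges of `G'` inside `S`, and the edges of `G` that do not end in `S`. -/
def splice (S : Set (Fin n)) (G G' : PDGraph n) : PDGraph n where
  E a b := (b ∈ S ∧ a ∈ S ∧ G'.E a b) ∨ (b ∉ S ∧ G.E a b)
  loopless a h := h.elim (fun h => G'.loopless a h.2.2) fun h => G.loopless a h.2

/-- No edge enters `S` from outside, so a source of `A ∩ S` with respect to `G'` is a source of `A`.
-/
theorem IsDAG.splice (hG : G.IsDAG) (hG' : G'.IsDAG) (S : Set (Fin n)) :
    (G.splice S G').IsDAG := by
  refine isDAG_of_exists_source fun A hA => ?_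
  by_cases hAS : (A ∩ S).Nonempty
  · obtain ⟨a, ha, hmin⟩ := hG'.exists_source hAS
    refine ⟨a, ha.1, fun b hb hba => ?_⟩
    rcases hba with h | h
    · exact hmin b ⟨hb, h.2.1⟩ h.2.2
    · exact h.1 ha.2
  · obtain ⟨a, ha, hmin⟩ := hG.exists_source hA
    refine ⟨a, ha, fun b hb hba => ?_⟩
    rcases hba with h | h
    · exact hAS ⟨a, ha, h.1⟩
    · exact hmin b hb h.2

/-- As `S` is ancestral in `G`, the parents of a vertex lie with it in `S`, where v-structures are
those of `G'`, or the vertex is outside `S` and keeps its parents from `G`. -/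
theorem SameSkeletonVStructures.splice (hG : G.IsDAG) (hG' : G'.IsDAG)
    (h : G.SameSkeletonVStructures G') {S : Set (Fin n)}
    (hS : ∀ a b, G.E a b → b ∈ S → a ∈ S) : G.SameSkeletonVStructures (G.splice S G') := by
  have hK := hG.splice hG' S
  have hadj : ∀ x y, G.Adj x y ↔ (G.splice S G').Adj x y := by
    intro x y
    have h1 := h.1 x y
    have h2 := hS x y
    have h3 := hS y x
    simp only [Adj, PDGraph.splice] at *
    tauto
  refine ⟨hadj, fun x y z => ?_⟩
  have hv := h.2 x y z
  have h1 := hS x y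
  have h2 := hS z y
  have h3 := hadj x z
  have h4 := h.1 x z
  simp only [VStructure, hG.directed_iff, hG'.directed_iff, hK.directed_iff, ← h3, ← h4] at *
  simp only [PDGraph.splice]
  tauto

/-- Reverse the edge `x → y`. -/
def reverse (G : PDGraph n) (x y : Fin n) (hxy : x ≠ y) : PDGraph n where
  E a b := (a = y ∧ b = x) ∨ (G.E a b ∧ ¬ (a = x ∧ b = y))
  loopless a h := h.elim (fun h => hxy (h.2.symm.trans h.1)) fun h => G.loopless a h.1

/-- If the source of `A` is `x` and `y ∈ A`, then `y` is a source after the reversal, since its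
remaining parents are parents of `x`. -/
theorem IsDAG.reverse (hG : G.IsDAG) (hxy : x ≠ y)
    (hcov : ∀ p, p ≠ x → (G.E p x ↔ G.E p y)) : (G.reverse x y hxy).IsDAG := by
  refine isDAG_of_exists_source fun A hA => ?_
  obtain ⟨a, ha, hmin⟩ := hG.exists_source hA
  by_cases hax : a = x ∧ y ∈ A
  · obtain ⟨rfl, hy⟩ := hax
    refine ⟨y, hy, fun b hb hby => ?_⟩
    rcases hby with h | h
    · exact hxy h.2.symm
    · have hb' : b ≠ a := fun h' => h.2 ⟨h', rfl⟩
      exact hmin b hb ((hcov b hb').2 h.1)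
  · refine ⟨a, ha, fun b hb hba => ?_⟩
    rcases hba with h | h
    · exact hax ⟨h.2, h.1 ▸ hb⟩
    · exact hmin b hb h.1

/-- A v-structure using the edge between `x` and `y`, before or after reversal, would need a parent
of one endpoint not adjacent to the other; a covered edge has none. -/
theorem SameSkeletonVStructures.reverse (hG : G.IsDAG) (hE : G.E x y) (hxy : x ≠ y)
    (hcov : ∀ p, p ≠ x → (G.E p x ↔ G.E p y)) :
    G.SameSkeletonVStructures (G.reverse x y hxy) := by
  have hK := hG.reverse hxy hcov
  have hadj : ∀ a b, G.Adj a b ↔ (G.reverse x y hxy).Adj a b := by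
    intro a b
    simp only [Adj, PDGraph.reverse]
    grind
  refine ⟨hadj, fun a b c => ?_⟩
  simp only [VStructure, hG.directed_iff, hK.directed_iff, ← hadj]
  simp only [PDGraph.reverse, Adj]
  have h1 := hcov a
  have h2 := hcov c
  grind

end PDGraph

/-! ### Structure of CPDAGs. -/

namespace MEC

variable {n : ℕ} {γ γ' : MEC n} {G G' : DAG n} {x y z : Fin n}

theorem Mem.same (h : γ.Mem G) (h' : γ.Mem G') : G.1.SameSkeletonVStructures G'.1 :=
  Quotient.exact (h.trans h'.symm)

theorem Mem.of_same (h : γ.Mem G) (h' : G.1.SameSkeletonVStructures G'.1) : γ.Mem G' :=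
  (Quotient.sound (s := DAG.markovEquivalence n) h').symm.trans h

theorem exists_mem (γ : MEC n) : ∃ G, γ.Mem G := Quotient.exists_rep γ

theorem cpdag_E : γ.cpdag.E x y ↔ ∃ G : DAG n, γ.Mem G ∧ G.1.E x y := by
  simp only [cpdag]
  exact exists_congr fun G => and_congr_right fun _ => G.2.directed_iff

theorem cpdag_directed_iff : γ.cpdag.Directed x y ↔ ∀ G : DAG n, γ.Mem G → G.1.E x y := by
  rw [cpdag_directed]
  exact forall_congr' fun G => imp_congr_right fun _ => G.2.directed_iff

theorem Mem.adj_iff (h : γ.Mem G) : G.1.Adj x y ↔ γ.cpdag.Adj x y := by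
  constructor
  · exact fun k => k.imp (fun k => cpdag_E.2 ⟨G, h, k⟩) fun k => cpdag_E.2 ⟨G, h, k⟩
  · rintro (k | k) <;> obtain ⟨G', h', k⟩ := cpdag_E.1 k
    · exact ((h.same h').1 x y).2 (Or.inl k)
    · exact ((h.same h').1 x y).2 (Or.inr k)

theorem Mem.directed_of_parents (h : γ.Mem G) (hxy : G.1.E x y) (hzy : G.1.E z y) (hne : x ≠ z)
    (hadj : ¬ γ.cpdag.Adj x z) : γ.cpdag.Directed x y := by
  rw [cpdag_directed]
  intro G' h'
  exact (((h.same h').2 x y z).1 ⟨hne, G.2.directed_iff.2 hxy, G.2.directed_iff.2 hzy,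
    fun k => hadj (h.adj_iff.1 k)⟩).2.1

theorem Mem.adj_of_parents (h : γ.Mem G) (hxy : G.1.E x y) (hzy : G.1.E z y) (hne : x ≠ z)
    (hu : γ.cpdag.Undirected x y) : γ.cpdag.Adj x z := by
  by_contra hadj
  exact (h.directed_of_parents hxy hzy hne hadj).2 hu.2

theorem Mem.splice (h : γ.Mem G) (h' : γ.Mem G') {S : Set (Fin n)}
    (hS : ∀ a b, G.1.E a b → b ∈ S → a ∈ S) :
    γ.Mem ⟨G.1.splice S G'.1, G.2.splice G'.2 S⟩ :=
  h.of_same (.splice G.2 G'.2 (h.same h') hS)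

/-- Some member of the class has no parents of `v` other than the compelled ones. -/
theorem exists_mem_parents_directed (γ : MEC n) (v : Fin n) :
    ∃ G, γ.Mem G ∧ ∀ p, G.1.E p v → γ.cpdag.Directed p v := by
  obtain ⟨G, hG, hmin⟩ := Set.exists_min_image {G : DAG n | γ.Mem G}
    (fun G => {p | G.1.E p v}.ncard) (by
      have h : Finite (PDGraph n) :=
        Finite.of_injective (fun G : PDGraph n => G.E) (fun _ _ h => PDGraph.ext h)
      have h' : Finite (DAG n) := Subtype.finite
      exact Set.toFinite _) γ.exists_mem
  refine ⟨G, hG, fun p hp => cpdag_directed_iff.2 fun G' hG' => ?_⟩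
  by_contra hp'
  -- Replacing the orientation on the ancestors of `v` by that of `G'` adds no parent to `v`, by
  -- acyclicity of `G`, and loses `p`. This contradicts the minimal number of parents.
  have hS : ∀ a b, G.1.E a b → b ∈ {u | Relation.ReflTransGen G.1.E u v} →
      a ∈ {u | Relation.ReflTransGen G.1.E u v} := fun a b hab hb => .head hab hb
  have hlt : {q | (G.1.splice {u | Relation.ReflTransGen G.1.E u v} G'.1).E q v}.ncard <
      {q | G.1.E q v}.ncard := by
    refine Set.ncard_lt_ncard ⟨?_, fun hsub => ?_⟩ (Set.toFinite _)
    · rintro q (⟨-, hq, hqv⟩ | hq)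
      · rcases (hG.adj_iff.2 (hG'.adj_iff.1 (Or.inl hqv))) with h | h
        · exact h
        · exact absurd (Relation.TransGen.head' h hq) (G.2.transGen_irrefl v)
      · exact hq.2
    · rcases hsub hp with h | h
      · exact hp' h.2.2
      · exact h.1 Relation.ReflTransGen.refl
  exact absurd (hmin _ (hG.splice hG' hS)) (not_le.2 hlt)

theorem Mem.exists_reverse (h : γ.Mem G) (hxy : G.1.E x y)
    (hcov : ∀ p, p ≠ x → (G.1.E p x ↔ G.1.E p y)) : ∃ G', γ.Mem G' ∧ G'.1.E y x := by
  have hne : x ≠ y := by rintro rfl; exact G.1.loopless x hxy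
  exact ⟨⟨G.1.reverse x y hne, G.2.reverse hne hcov⟩, h.of_same (.reverse G.2 hxy hne hcov),
    Or.inl ⟨rfl, rfl⟩⟩

theorem Mem.E_or (h : γ.Mem G) (hadj : γ.cpdag.Adj x y) : G.1.E x y ∨ G.1.E y x :=
  h.adj_iff.2 hadj

theorem Mem.trans_of_adj (h : γ.Mem G) (hxy : G.1.E x y) (hyz : G.1.E y z)
    (hadj : γ.cpdag.Adj x z) : G.1.E x z := by
  refine (h.E_or hadj).resolve_right fun hzx => G.2.transGen_irrefl x ?_
  exact .tail (.tail (.single hxy) hyz) hzx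

/-- A CPDAG has no triangle with exactly one directed edge. -/
theorem cpdag_no_triangle {y b x : Fin n} (hyb : γ.cpdag.Directed y b)
    (hbx : γ.cpdag.Undirected b x) (hyx : γ.cpdag.Undirected y x) : False := by
  have dir : ∀ {u v}, γ.cpdag.Directed u v → ∀ {G : DAG n}, γ.Mem G → G.1.E u v :=
    fun h G hG => cpdag_directed_iff.1 h G hG
  -- The member `K` glued from `B` and `X` will contain a covered edge `w → b` that is compelled;
  -- reversing it is the contradiction. Outside the proper ancestors `S` of `b`, `K` follows `B`, so
  -- that `b → x` and all parents of `b` are compelled.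
  obtain ⟨B, hB, hBpar⟩ := γ.exists_mem_parents_directed b
  obtain ⟨X, hX, hXpar⟩ := γ.exists_mem_parents_directed x
  have hBbx : B.1.E b x := (hB.E_or (Or.inl hbx.1)).resolve_right fun h => (hBpar _ h).2 hbx.1
  set S : Set (Fin n) := {u | Relation.TransGen B.1.E u b} with hSdef
  have hS : ∀ u v, B.1.E u v → v ∈ S → u ∈ S := fun u v huv hv => .head huv hv
  have hbS : b ∉ S := B.2.transGen_irrefl b
  have hxS : x ∉ S := fun h => B.2.transGen_irrefl b (.head hBbx h)
  have hK := hB.splice hX hS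
  set K : DAG n := ⟨B.1.splice S X.1, B.2.splice X.2 S⟩ with hKdef
  have hKin : ∀ {u v}, v ∈ S → K.1.E u v → u ∈ S ∧ X.1.E u v := by
    rintro u v hv (h | h)
    · exact h.2
    · exact absurd hv h.1
  have hKout : ∀ {u v}, v ∉ S → K.1.E u v → B.1.E u v := by
    rintro u v hv (h | h)
    · exact absurd h.1 hv
    · exact h.2
  have hKbx : K.1.E b x := Or.inr ⟨hxS, hBbx⟩
  have hKb : ∀ {p}, K.1.E p b → p ∈ S ∧ γ.cpdag.Directed p b := fun {p} h =>
    ⟨.single (hKout hbS h), hBpar _ (hKout hbS h)⟩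
  have hXx : ∀ {p}, γ.cpdag.Undirected p x → X.1.E x p := fun {p} h =>
    (hX.E_or (Or.inr h.1)).resolve_right fun h' => (hXpar _ h').2 h.2
  -- Taking `w` last in the order of `X` ensures that no other such vertex is a child of `w` in `X`,
  -- hence none in `S` is a child of `w` in `K`.
  obtain ⟨w, ⟨hwb, hwx⟩, hlast⟩ := X.2.exists_sink
    (A := {w | γ.cpdag.Directed w b ∧ γ.cpdag.Undirected w x}) ⟨y, hyb, hyx⟩
  have hKwb := dir hwb hK
  have hwS : w ∈ S := (hKb hKwb).1
  have hKwx : K.1.E w x := hK.trans_of_adj hKwb hKbx (Or.inl hwx.1)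
  have hcov : ∀ p, p ≠ w → (K.1.E p w ↔ K.1.E p b) := by
    intro p hpw
    constructor
    · intro hp
      obtain ⟨hpS, hXp⟩ := hKin hwS hp
      have hpx : p ≠ x := fun h => hxS (h ▸ hpS)
      have hadj : γ.cpdag.Adj x p :=
        hX.adj_of_parents (hXx hwx) hXp hpx.symm ⟨hwx.2, hwx.1⟩
      have hKpx : K.1.E p x := hK.trans_of_adj hp hKwx hadj.symm
      have hpb : p ≠ b := fun h => hbS (h ▸ hpS)
      have hadj' := hK.adj_of_parents hKbx hKpx hpb.symm hbx
      exact hK.trans_of_adj hp hKwb hadj'.symm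
    · intro hp
      obtain ⟨hpS, hpb⟩ := hKb hp
      have hpx : p ≠ x := fun h => hxS (h ▸ hpS)
      have hadj : γ.cpdag.Adj x p := by
        obtain ⟨G, hG, hxb⟩ := cpdag_E.1 hbx.2
        exact hG.adj_of_parents hxb (dir hpb hG) hpx.symm ⟨hbx.2, hbx.1⟩
      have hKpx : K.1.E p x := hK.trans_of_adj hp hKbx hadj.symm
      have hadj' : γ.cpdag.Adj w p := hK.adj_of_parents hKwx hKpx hpw.symm hwx
      refine (hK.E_or hadj').resolve_left fun hKwp => ?_
      have hXwp := (hKin hpS hKwp).2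
      by_cases hu : γ.cpdag.Undirected p x
      · exact hlast p ⟨hpb, hu⟩ hXwp
      -- Here `p → x` is compelled, and `X` has `x → w`, so `w → p` would close a cycle in `X`.
      · have hpx' : X.1.E p x := by
          have hpx' := cpdag_E.2 ⟨K, hK, hKpx⟩
          exact dir ⟨hpx', fun h => hu ⟨hpx', h⟩⟩ hX
        exact X.2.asymm hXwp (hX.trans_of_adj hpx' (hXx hwx) hadj'.symm)
  obtain ⟨G, hG, hbw⟩ := hK.exists_reverse hKwb hcov
  exact G.2.asymm hbw (dir hwb hG)

end MEC

/-! ### Local moves as operators, connectedness and detailed balance. -/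

namespace MEC

variable {n : ℕ} {γ γ' : MEC n} {G G' : DAG n}

theorem isCompletion_of_mem {P : PDGraph n} (h : γ.Mem G) (hP : G.1.SameSkeletonVStructures P) :
    IsCompletion P γ := fun _ hG' =>
  PDGraph.sameSkeletonVStructures_equivalence.trans (hG'.same h) hP

/-- The set `T` collects the undirected edges `t - y` whose orientation `t → y` in `G` forms a new
v-structure with `x → y`. A v-structure without the new edge was already one of `G`, hence
compelled. -/
theorem mem_insertSet (hG : γ.Mem G) (hG' : γ'.Mem G') (h : G.1.IsEdgeInsertion G'.1) :
    γ' ∈ γ.insertSet := by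
  have hloc : IsLocalMove γ γ' := ⟨G, G', hG, hG', Or.inl h⟩
  obtain ⟨x, y, hxy, hadj, hE⟩ := h
  set P := γ.cpdag with hP
  have hPadj : ∀ {a b}, G.1.Adj a b ↔ P.Adj a b := hG.adj_iff
  have hdir : ∀ {a b}, P.Directed a b → G.1.E a b := fun h => cpdag_directed_iff.1 h G hG
  have hPE : ∀ {a b}, G.1.E a b → P.E a b := fun h => cpdag_E.2 ⟨G, hG, h⟩
  have hnP : ¬ P.Adj x y := fun h => hadj (hPadj.2 h)
  refine ⟨x, y, {t | P.Undirected t y ∧ G.1.E t y ∧ ¬ P.Adj t x}, ⟨hxy, hnP,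
    fun t ht => ⟨ht.1, ht.2.2⟩, isCompletion_of_mem hG' (.of_directed ?_ ?_ ?_)⟩, hloc⟩
  · intro a b
    have h1 := @hPadj a b
    have h2 := P.loopless a
    have h3 := @PDGraph.IsDAG.asymm n G.1 a b G.2
    simp only [PDGraph.Adj, PDGraph.insertEdge, hE, PDGraph.Undirected, Set.mem_ofPred_eq] at *
    grind
  · intro a b hab
    refine G'.2.directed_iff.2 ((hE a b).2 ?_)
    have h1 := @hPadj a b
    have h2 := @hdir a b
    simp only [PDGraph.Adj, PDGraph.insertEdge, PDGraph.Directed, PDGraph.Undirected,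
      Set.mem_ofPred_eq] at *
    grind
  · intro a b c hv
    have hab : a ≠ b := by rintro rfl; exact G'.1.loopless _ hv.2.1.1
    have hac : ¬ G.1.Adj a c := fun h =>
      hv.2.2.2 (h.imp (fun h => (hE _ _).2 (Or.inl h)) fun h => (hE _ _).2 (Or.inl h))
    have h1 : G.1.E a b → G.1.E c b → P.Directed a b := fun h h' =>
      hG.directed_of_parents h h' hv.1 fun k => hac (hPadj.2 k)
    have h2 := (hE a b).1 hv.2.1.1
    have h3 := (hE c b).1 hv.2.2.1.1
    have h4 := @hPE a b
    have h5 := @hPadj a c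
    simp only [PDGraph.Adj, PDGraph.insertEdge, PDGraph.Directed, PDGraph.Undirected,
      Set.mem_ofPred_eq] at *
    grind

theorem mem_deleteSet (hG : γ.Mem G) (hG' : γ'.Mem G') (h : G'.1.IsEdgeInsertion G.1) :
    γ' ∈ γ.deleteSet := by
  have hloc : IsLocalMove γ γ' := ⟨G, G', hG, hG', Or.inr h⟩
  obtain ⟨x, y, hxy, hadj, hE⟩ := h
  set P := γ.cpdag with hP
  have hPadj : ∀ {a b}, G.1.Adj a b ↔ P.Adj a b := hG.adj_iff
  have hdir : ∀ {a b}, P.Directed a b → G.1.E a b := fun h => cpdag_directed_iff.1 h G hG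
  have hPE : ∀ {a b}, G.1.E a b → P.E a b := fun h => cpdag_E.2 ⟨G, hG, h⟩
  have hGxy : G.1.E x y := (hE x y).2 (Or.inr ⟨rfl, rfl⟩)
  have hle : ∀ {a b}, G'.1.E a b → G.1.E a b := fun h => (hE _ _).2 (Or.inl h)
  have hasymm : ∀ {a b}, G.1.E a b → ¬ G.1.E b a := G.2.asymm
  -- `H` consists of the common children of `x` and `y` in `G` whose edge to `y` is not compelled;
  -- all orientations it imposes agree with `G`.
  refine ⟨x, y, {h | P.Undirected h y ∧ P.Adj h x ∧ G.1.E x h ∧ G.1.E y h}, ⟨?_,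
    fun t ht => ⟨ht.1, ht.2.1⟩, isCompletion_of_mem hG' (.of_directed ?_ ?_ ?_)⟩, hloc⟩
  · by_cases h : P.E y x
    · exact Or.inl ⟨hPE hGxy, h⟩
    · exact Or.inr ⟨hPE hGxy, h⟩
  · intro a b
    have h1 := @hPadj a b
    have h2 := hE a b
    have h3 := hE b a
    have h4 := @hPE a b
    have h5 := @hPE b a
    have h6 := @hasymm a b
    have h7 := @hle a b
    have h8 := @hle b a
    clear hE hPadj hPE hdir hloc hle hasymm
    simp only [PDGraph.Adj, PDGraph.deleteEdge, PDGraph.Undirected, Set.mem_ofPred_eq] at *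
    grind
  · intro a b hab
    refine G'.2.directed_iff.2 ?_
    have h1 := hE a b
    have h2 := @hdir a b
    clear hE hPadj hPE hdir hloc hle hasymm
    simp only [PDGraph.Adj, PDGraph.deleteEdge, PDGraph.Directed, PDGraph.Undirected,
      Set.mem_ofPred_eq] at *
    grind
  · intro a b c hv
    have hGab := hle hv.2.1.1
    have hGcb := hle hv.2.2.1.1
    have hedge : ¬ ((a = x ∧ b = y) ∨ (a = y ∧ b = x)) := by
      rintro (⟨rfl, rfl⟩ | ⟨rfl, rfl⟩)
      · exact hadj (Or.inl hv.2.1.1)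
      · exact hadj (Or.inr hv.2.1.1)
    by_cases hac : G.1.Adj a c
    · have hcase : (a = x ∧ c = y) ∨ (a = y ∧ c = x) := by
        have hn := hv.2.2.2
        simp only [PDGraph.Adj, hE] at hac hn
        tauto
      have hxb : G.1.E x b := by rcases hcase with ⟨rfl, rfl⟩ | ⟨rfl, rfl⟩ <;> assumption
      have hyb : G.1.E y b := by rcases hcase with ⟨rfl, rfl⟩ | ⟨rfl, rfl⟩ <;> assumption
      by_cases hby : P.E b y
      · have hbH : b ∈ {h | P.Undirected h y ∧ P.Adj h x ∧ G.1.E x h ∧ G.1.E y h} :=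
          ⟨⟨hby, hPE hyb⟩, Or.inr (hPE hxb), hxb, hyb⟩
        have haxy : a = x ∨ a = y := hcase.imp And.left And.left
        refine ⟨⟨hPE hGab, hedge, fun h => hasymm hGab ?_⟩, fun h => h.2.2 ⟨hbH, haxy, hPE hGab⟩⟩
        rcases h.2.1 with rfl | rfl
        · exact h.1.2.2.1
        · exact h.1.2.2.2
      · have hdyb : P.Directed y b := ⟨hPE hyb, hby⟩
        -- If `x - y` is undirected, an undirected `x - b` would give a forbidden triangle. If `x →
        -- y` is compelled, `x → y → b` forces `x → b` in every member.
        have hdxb : P.Directed x b := by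
          by_cases hyx : P.E y x
          · exact ⟨hPE hxb, fun h => cpdag_no_triangle hdyb ⟨h, hPE hxb⟩ ⟨hyx, hPE hGxy⟩⟩
          · exact cpdag_directed_iff.2 fun K hK => hK.trans_of_adj
              (cpdag_directed_iff.1 ⟨hPE hGxy, hyx⟩ K hK) (cpdag_directed_iff.1 hdyb K hK)
              (Or.inl (hPE hxb))
        have hdab : P.Directed a b := by
          rcases hcase with ⟨rfl, rfl⟩ | ⟨rfl, rfl⟩ <;> assumption
        exact ⟨⟨hdab.1, hedge, fun h => hdab.2 h.2.2⟩, fun h => hdab.2 h.1⟩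
    · have hdab : P.Directed a b :=
        hG.directed_of_parents hGab hGcb hv.1 fun h => hac (hPadj.2 h)
      exact ⟨⟨hdab.1, hedge, fun h => hdab.2 h.2.2⟩, fun h => hdab.2 h.1⟩

theorem IsLocalMove.symm (h : IsLocalMove γ γ') : IsLocalMove γ' γ := by
  obtain ⟨G, G', hG, hG', h⟩ := h
  exact ⟨G', G, hG', hG, h.symm⟩

/-- Every local move is realised by an Insert or a Delete operation. -/
theorem mem_insertSet_union_deleteSet : γ' ∈ γ.insertSet ∪ γ.deleteSet ↔ IsLocalMove γ γ' := by
  constructor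
  · rintro (⟨x, y, T, -, h⟩ | ⟨x, y, T, -, h⟩) <;> exact h
  · rintro ⟨G, G', hG, hG', h | h⟩
    · exact Or.inl (mem_insertSet hG hG' h)
    · exact Or.inr (mem_deleteSet hG hG' h)

/-- The class of the DAG without edges. -/
def empty (n : ℕ) : MEC n :=
  Quotient.mk _ (⟨⟨fun _ _ => False, fun _ h => h⟩, PDGraph.isDAG_of_wellFounded
    ⟨fun _ => ⟨_, fun _ h => h.elim⟩⟩⟩ : DAG n)

/-- Removing any edge of a DAG leaves a DAG, so induction on the number of edges applies. -/
theorem reflTransGen_isLocalMove_empty (γ : MEC n) :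
    Relation.ReflTransGen IsLocalMove γ (empty n) := by
  suffices H : ∀ (k : ℕ) (G : DAG n), {q : Fin n × Fin n | G.1.E q.1 q.2}.ncard = k →
      Relation.ReflTransGen IsLocalMove (Quotient.mk _ G : MEC n) (empty n) by
    obtain ⟨G, rfl⟩ := γ.exists_mem
    exact H _ G rfl
  intro k
  induction k using Nat.strong_induction_on with
  | _ k ih =>
    intro G hk
    by_cases hG : ∃ x y, G.1.E x y
    · obtain ⟨x, y, hxy⟩ := hG
      let D : PDGraph n := ⟨fun a b => G.1.E a b ∧ ¬ (a = x ∧ b = y), fun a h => G.1.loopless a h.1⟩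
      let G' : DAG n := ⟨D, G.2.mono fun _ _ h => h.1⟩
      have hmove : IsLocalMove (Quotient.mk _ G : MEC n) (Quotient.mk _ G') := by
        refine ⟨G, G', rfl, rfl, Or.inr ⟨x, y, ?_, ?_, fun a b => ?_⟩⟩
        · rintro rfl
          exact G.1.loopless _ hxy
        · rintro (h | h)
          · exact h.2 ⟨rfl, rfl⟩
          · exact G.2.asymm hxy h.1
        · by_cases h : a = x ∧ b = y
          · obtain ⟨rfl, rfl⟩ := h
            simp [hxy]
          · simp [G', D, h]
      refine .head hmove (ih _ ?_ G' rfl)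
      rw [← hk]
      refine Set.ncard_lt_ncard ⟨fun q hq => hq.1, fun hsub => ?_⟩ (Set.toFinite _)
      have h : (x, y) ∈ {q : Fin n × Fin n | G'.1.E q.1 q.2} := hsub hxy
      exact h.2 ⟨rfl, rfl⟩
    · have : (Quotient.mk _ G : MEC n) = empty n := by
        refine congrArg _ (Subtype.ext (PDGraph.ext ?_))
        funext x y
        exact propext ⟨fun h => hG ⟨x, y, h⟩, False.elim⟩
      rw [this]

instance : Std.Symm (IsLocalMove (n := n)) := ⟨fun _ _ h => h.symm⟩

theorem reflTransGen_isLocalMove (γ γ' : MEC n) : Relation.ReflTransGen IsLocalMove γ γ' :=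
  γ.reflTransGen_isLocalMove_empty.trans
    (Relation.ReflTransGen.stdSymm.symm _ _ γ'.reflTransGen_isLocalMove_empty)

theorem zanellaRate_nonneg {g : ℝ → ℝ} {π : MEC n → ℝ} (hg : ∀ t, 0 < t → 0 < g t)
    (hπ : ∀ γ, 0 < π γ) (γ η : MEC n) : 0 ≤ zanellaRate g π γ η := by
  rw [zanellaRate]
  split_ifs
  · exact (hg _ (div_pos (hπ _) (hπ _))).le
  · exact le_rfl

theorem IsLocalMove.zanellaRate_pos {g : ℝ → ℝ} {π : MEC n → ℝ} (hg : ∀ t, 0 < t → 0 < g t)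
    (hπ : ∀ γ, 0 < π γ) (h : IsLocalMove γ γ') : 0 < zanellaRate g π γ γ' := by
  rw [zanellaRate, if_pos (mem_insertSet_union_deleteSet.2 h)]
  exact hg _ (div_pos (hπ _) (hπ _))

theorem zanellaRate_reversible {g : ℝ → ℝ} {π : MEC n → ℝ}
    (hg : ∀ t, 0 < t → g t = t * g (1 / t)) (hπ : ∀ γ, 0 < π γ) (γ η : MEC n) :
    π γ * zanellaRate g π γ η = π η * zanellaRate g π η γ := by
  by_cases h : IsLocalMove γ η
  · rw [zanellaRate, zanellaRate, if_pos (mem_insertSet_union_deleteSet.2 h),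
      if_pos (mem_insertSet_union_deleteSet.2 h.symm), hg _ (div_pos (hπ η) (hπ γ)), one_div_div,
      ← mul_assoc, mul_div_cancel₀ _ (hπ γ).ne']
  · rw [zanellaRate, zanellaRate, if_neg fun k => h (mem_insertSet_union_deleteSet.1 k),
      if_neg fun k => h (mem_insertSet_union_deleteSet.1 k).symm, mul_zero, mul_zero]

end MEC

/-! ### Positivity, uniqueness and convergence of transition functions. -/

section Kernels

variable {S : Type*} [Fintype S]

theorem sum_abs_sum_mul_le (v : S → ℝ) {A : S → S → ℝ} {m : ℝ}
    (hA : ∀ c, ∑ b, |A c b| ≤ m) : ∑ b, |∑ c, v c * A c b| ≤ m * ∑ c, |v c| := by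
  calc ∑ b, |∑ c, v c * A c b| ≤ ∑ b, ∑ c, |v c| * |A c b| := by
        refine Finset.sum_le_sum fun b _ => (Finset.abs_sum_le_sum_abs _ _).trans_eq ?_
        simp only [abs_mul]
    _ = ∑ c, |v c| * ∑ b, |A c b| := by
        rw [Finset.sum_comm]
        simp only [Finset.mul_sum]
    _ ≤ ∑ c, |v c| * m := Finset.sum_le_sum fun c _ =>
        mul_le_mul_of_nonneg_left (hA c) (abs_nonneg _)
    _ = m * ∑ c, |v c| := by rw [← Finset.sum_mul, mul_comm]

end Kernels

namespace IsTransitionFunction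

variable {S : Type*} [Fintype S] {lam : S → S → ℝ} {p q : ℝ≥0 → S → S → ℝ}

theorem sum_abs_eq_one (hp : IsTransitionFunction lam p) (t : ℝ≥0) (a : S) :
    ∑ b, |p t a b| = 1 := by
  simp only [abs_of_nonneg (hp.nonneg _ _ _), hp.sum_eq_one]

theorem mul_le (hp : IsTransitionFunction lam p) (s t : ℝ≥0) (a b c : S) :
    p s a b * p t b c ≤ p (s + t) a c := by
  rw [hp.chapman_kolmogorov]
  exact Finset.single_le_sum (f := fun b => p s a b * p t b c)
    (fun i _ => mul_nonneg (hp.nonneg _ _ _) (hp.nonneg _ _ _)) (Finset.mem_univ b)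

theorem self_eq (hp : IsTransitionFunction lam p) [DecidableEq S] (t : ℝ≥0) (a : S) :
    p t a a = 1 - ∑ b ∈ Finset.univ.erase a, p t a b := by
  rw [← hp.sum_eq_one t a, ← Finset.add_sum_erase _ _ (Finset.mem_univ a), add_sub_cancel_right]

theorem tendsto_coe_nhdsGT_zero : Tendsto (fun h : ℝ≥0 => (h : ℝ)) (𝓝[>] 0) (𝓝 0) :=
  (NNReal.continuous_coe.tendsto' 0 0 rfl).mono_left nhdsWithin_le_nhds

theorem tendsto_ne (hp : IsTransitionFunction lam p) {a b : S} (hab : a ≠ b) :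
    Tendsto (fun h => p h a b) (𝓝[>] 0) (𝓝 0) := by
  have h := (hp.intensity a b hab).mul tendsto_coe_nhdsGT_zero
  rw [mul_zero] at h
  refine h.congr' ?_
  filter_upwards [self_mem_nhdsWithin] with h hh
  exact div_mul_cancel₀ _ (NNReal.coe_ne_zero.2 (ne_of_gt hh))

theorem tendsto_self (hp : IsTransitionFunction lam p) (a : S) :
    Tendsto (fun h => p h a a) (𝓝[>] 0) (𝓝 1) := by
  classical
  simp only [hp.self_eq _ a]
  have := tendsto_finsetSum (Finset.univ.erase a)
    fun b hb => hp.tendsto_ne (Finset.ne_of_mem_erase hb).symm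
  simpa using this.const_sub 1

theorem tendsto_div_nat {t : ℝ≥0} (ht : 0 < t) :
    Tendsto (fun k : ℕ => t / (k + 1 : ℕ)) atTop (𝓝[>] 0) := by
  refine tendsto_nhdsWithin_iff.2 ⟨?_, Eventually.of_forall fun k => ?_⟩
  · refine NNReal.tendsto_coe.1 ?_
    simpa [Function.comp_def] using
      (tendsto_const_div_atTop_nhds_zero_nat (t : ℝ)).comp (tendsto_add_atTop_nat 1)
  · exact div_pos ht (Nat.cast_pos.2 k.succ_pos)

/-- The probability of staying tends to 1 at small times, and remaining at `a` over many short steps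
bounds `p t a a` from below. -/
theorem pos_self (hp : IsTransitionFunction lam p) (t : ℝ≥0) (a : S) : 0 < p t a a := by
  rcases eq_or_lt_of_le (zero_le (a := t)) with rfl | ht
  · rw [hp.zero_self]
    exact one_pos
  obtain ⟨k, hk⟩ := ((tendsto_div_nat ht).eventually
    ((hp.tendsto_self a).eventually (lt_mem_nhds one_pos))).exists
  have hpow : ∀ j : ℕ, 0 < p (j * (t / (k + 1 : ℕ))) a a := by
    intro j
    induction j with
    | zero => simp [hp.zero_self]
    | succ j ih =>
      rw [Nat.cast_succ, add_mul, one_mul]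
      exact (mul_pos ih hk).trans_le (hp.mul_le _ _ _ _ _)
  have := hpow (k + 1)
  rwa [mul_div_cancel₀ _ (by positivity)] at this

theorem pos_of_rate_pos (hp : IsTransitionFunction lam p) {a b : S} (h : 0 < lam a b)
    {t : ℝ≥0} (ht : 0 < t) : 0 < p t a b := by
  by_cases hab : a = b
  · exact hab ▸ hp.pos_self t a
  have h1 := (hp.intensity a b hab).eventually (lt_mem_nhds h)
  have h2 : ∀ᶠ s in 𝓝[>] (0 : ℝ≥0), s < t := nhdsWithin_le_nhds (gt_mem_nhds ht)
  obtain ⟨s, hs, hst, hs0⟩ := (h1.and (h2.and self_mem_nhdsWithin)).exists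
  have hs' : 0 < p s a b := by
    by_contra hneg
    rw [le_antisymm (not_lt.1 hneg) (hp.nonneg _ _ _), zero_div] at hs
    exact lt_irrefl _ hs
  rw [← add_tsub_cancel_of_le hst.le]
  exact (mul_pos hs' (hp.pos_self (t - s) b)).trans_le (hp.mul_le _ _ _ _ _)

theorem pos_of_reflTransGen (hp : IsTransitionFunction lam p) {a b : S}
    (h : Relation.ReflTransGen (fun a b => 0 < lam a b) a b) {t : ℝ≥0} (ht : 0 < t) :
    0 < p t a b := by
  induction h generalizing t with
  | refl => exact hp.pos_self t a
  | tail _ hbc ih =>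
    rw [← add_halves t]
    exact (mul_pos (ih (half_pos ht)) (hp.pos_of_rate_pos hbc (half_pos ht))).trans_le
      (hp.mul_le _ _ _ _ _)

/-! ### Uniqueness -/

theorem tendsto_sub_div (hp : IsTransitionFunction lam p) (hq : IsTransitionFunction lam q)
    (a b : S) : Tendsto (fun h : ℝ≥0 => (p h a b - q h a b) / (h : ℝ)) (𝓝[>] 0) (𝓝 0) := by
  classical
  have hne : ∀ a b, a ≠ b →
      Tendsto (fun h : ℝ≥0 => (p h a b - q h a b) / (h : ℝ)) (𝓝[>] 0) (𝓝 0) := by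
    intro a b hab
    have := (hp.intensity a b hab).sub (hq.intensity a b hab)
    simpa only [sub_self, ← sub_div] using this
  by_cases hab : a = b
  · subst hab
    have h := (tendsto_finsetSum (Finset.univ.erase a)
      fun b hb => hne a b (Finset.ne_of_mem_erase hb).symm).neg
    simp only [Finset.sum_const_zero, neg_zero] at h
    refine h.congr fun t => ?_
    rw [hp.self_eq, hq.self_eq, ← Finset.sum_div, Finset.sum_sub_distrib, ← neg_div]
    congr 1
    ring
  · exact hne a b hab

/-- Telescoping: stochastic matrices do not increase the ℓ¹ norm, so each step adds at most the
one-step error, bounded crudely by its sum over all starting states. -/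
theorem sum_abs_sub_le (hp : IsTransitionFunction lam p) (hq : IsTransitionFunction lam q)
    (h : ℝ≥0) (k : ℕ) (a : S) :
    ∑ b, |p (k * h) a b - q (k * h) a b| ≤ k * ∑ c, ∑ b, |p h c b - q h c b| := by
  classical
  induction k with
  | zero =>
    have : ∀ b, p 0 a b = q 0 a b := fun b => by
      by_cases hab : a = b
      · rw [← hab, hp.zero_self, hq.zero_self]
      · rw [hp.zero_ne _ _ hab, hq.zero_ne _ _ hab]
    simp [this]
  | succ k ih =>
    rw [Nat.cast_succ, Nat.cast_succ, add_mul, one_mul, add_mul, one_mul]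
    have hsplit : ∀ b, p (k * h + h) a b - q (k * h + h) a b =
        ∑ c, (p (k * h) a c - q (k * h) a c) * p h c b +
          ∑ c, q (k * h) a c * (p h c b - q h c b) := fun b => by
      rw [hp.chapman_kolmogorov, hq.chapman_kolmogorov, ← Finset.sum_sub_distrib,
        ← Finset.sum_add_distrib]
      exact Finset.sum_congr rfl fun c _ => by ring
    have h1 := sum_abs_sum_mul_le (fun c => p (k * h) a c - q (k * h) a c)
      (A := p h) (m := 1) fun c => (hp.sum_abs_eq_one h c).le
    have h2 := sum_abs_sum_mul_le (q (k * h) a) (A := fun c b => p h c b - q h c b)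
      (m := ∑ c, ∑ b, |p h c b - q h c b|) fun c =>
        Finset.single_le_sum (f := fun c => ∑ b, |p h c b - q h c b|)
          (fun i _ => Finset.sum_nonneg fun _ _ => abs_nonneg _) (Finset.mem_univ c)
    rw [one_mul] at h1
    rw [hq.sum_abs_eq_one, mul_one] at h2
    calc ∑ b, |p (k * h + h) a b - q (k * h + h) a b|
        ≤ ∑ b, (|∑ c, (p (k * h) a c - q (k * h) a c) * p h c b| +
          |∑ c, q (k * h) a c * (p h c b - q h c b)|) :=
          Finset.sum_le_sum fun b _ => by rw [hsplit]; exact abs_add_le _ _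
      _ ≤ _ := by
          rw [Finset.sum_add_distrib]
          exact add_le_add (h1.trans ih) h2

/-- Over `k + 1` steps of length `h = t / (k + 1)` the total error is at most `t` times the one-step
error divided by `h`, which vanishes because the intensities agree. No differential equation is
needed. -/
theorem unique (hp : IsTransitionFunction lam p) (hq : IsTransitionFunction lam q) : p = q := by
  funext t a b
  rcases eq_or_lt_of_le (zero_le (a := t)) with rfl | ht
  · by_cases hab : a = b
    · rw [← hab, hp.zero_self, hq.zero_self]
    · rw [hp.zero_ne _ _ hab, hq.zero_ne _ _ hab]
  have hlim : Tendsto (fun h : ℝ≥0 => (t : ℝ) * ∑ c, ∑ b, |(p h c b - q h c b) / (h : ℝ)|)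
      (𝓝[>] 0) (𝓝 0) := by
    have := (tendsto_finsetSum Finset.univ fun c _ => tendsto_finsetSum Finset.univ
      fun b _ => (hp.tendsto_sub_div hq c b).abs).const_mul (t : ℝ)
    simpa using this
  have hle : ∀ k : ℕ, |p t a b - q t a b| ≤ (t : ℝ) * ∑ c, ∑ b,
      |(p (t / (k + 1 : ℕ)) c b - q (t / (k + 1 : ℕ)) c b) / ((t / (k + 1 : ℕ) : ℝ≥0) : ℝ)| := by
    intro k
    have hk : ((k + 1 : ℕ) : ℝ≥0) * (t / (k + 1 : ℕ)) = t := mul_div_cancel₀ _ (by positivity)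
    have h1 := hp.sum_abs_sub_le hq (t / (k + 1 : ℕ)) (k + 1) a
    rw [hk] at h1
    refine (Finset.single_le_sum (f := fun b => |p t a b - q t a b|)
      (fun _ _ => abs_nonneg _) (Finset.mem_univ b)).trans (h1.trans_eq ?_)
    simp only [abs_div, NNReal.abs_eq, ← Finset.sum_div]
    have ht' : (t : ℝ) ≠ 0 := NNReal.coe_ne_zero.2 ht.ne'
    push_cast
    field_simp
  have h0 := ge_of_tendsto' (hlim.comp (tendsto_div_nat ht)) hle
  exact sub_eq_zero.1 (abs_nonpos_iff.1 h0)

/-! ### Convergence to the stationary distribution -/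

/-- Doeblin contraction: `p t a - π` has total mass zero, so `ε * π b` may be subtracted from the
kernel without effect, leaving a nonnegative kernel with row sums `1 - ε`. -/
theorem sum_abs_sub_stationary_le (hp : IsTransitionFunction lam p) {π : S → ℝ}
    (hπ : π ∈ stdSimplex ℝ S) (hst : IsStationaryFor p π) {s : ℝ≥0} {ε : ℝ}
    (hε : ∀ a b, ε * π b ≤ p s a b) (t : ℝ≥0) (a : S) :
    ∑ b, |p (t + s) a b - π b| ≤ (1 - ε) * ∑ b, |p t a b - π b| := by
  have h : ∀ b, p (t + s) a b - π b = ∑ c, (p t a c - π c) * (p s c b - ε * π b) := fun b => by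
    have h1 : ∑ c, (p t a c - π c) * (ε * π b) = 0 := by
      rw [← Finset.sum_mul, Finset.sum_sub_distrib, hp.sum_eq_one, hπ.2, sub_self, zero_mul]
    simp only [mul_sub (p t a _ - π _), Finset.sum_sub_distrib, h1, sub_zero]
    simp only [sub_mul, Finset.sum_sub_distrib, ← hp.chapman_kolmogorov, hst s b]
  simp only [h]
  refine sum_abs_sum_mul_le _ fun c => le_of_eq ?_
  simp only [abs_of_nonneg (sub_nonneg.2 (hε c _)), Finset.sum_sub_distrib, hp.sum_eq_one,
    ← Finset.mul_sum, hπ.2, mul_one]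

theorem tendsto_stationary (hp : IsTransitionFunction lam p) {π : S → ℝ}
    (hπ : π ∈ stdSimplex ℝ S) (hst : IsStationaryFor p π) (hpos : ∀ a b, 0 < p 1 a b)
    (a b : S) : Tendsto (fun t => p t a b) atTop (𝓝 (π b)) := by
  have : Nonempty S := ⟨a⟩
  obtain ⟨⟨a₀, b₀⟩, hmin⟩ := Finite.exists_min fun x : S × S => p 1 x.1 x.2
  set ε := p 1 a₀ b₀ with hεdef
  have hε0 : 0 < ε := hpos _ _
  have hπ1 : ∀ b, π b ≤ 1 := fun b =>
    hπ.2 ▸ Finset.single_le_sum (fun i _ => hπ.1 i) (Finset.mem_univ b)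
  have hε : ∀ a b, ε * π b ≤ p 1 a b := fun a b =>
    (mul_le_of_le_one_right hε0.le (hπ1 b)).trans (hmin (a, b))
  have hε1 : ε ≤ 1 := by
    rw [← hp.sum_eq_one 1 a₀]
    exact Finset.single_le_sum (fun i _ => hp.nonneg 1 a₀ i) (Finset.mem_univ b₀)
  have hk : ∀ (k : ℕ) (r : ℝ≥0), ∑ b, |p (r + k) a b - π b| ≤ (1 - ε) ^ k * 2 := by
    intro k r
    induction k with
    | zero =>
      rw [Nat.cast_zero, add_zero, pow_zero, one_mul]
      calc ∑ b, |p r a b - π b| ≤ ∑ b, (p r a b + π b) := Finset.sum_le_sum fun b _ => by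
            refine (abs_sub _ _).trans_eq ?_
            rw [abs_of_nonneg (hp.nonneg _ _ _), abs_of_nonneg (hπ.1 _)]
        _ = 2 := by rw [Finset.sum_add_distrib, hp.sum_eq_one, hπ.2]; norm_num
    | succ k ih =>
      rw [Nat.cast_succ, ← add_assoc, pow_succ', mul_assoc]
      exact (hp.sum_abs_sub_stationary_le hπ hst hε _ a).trans
        (mul_le_mul_of_nonneg_left ih (sub_nonneg.2 hε1))
  rw [tendsto_iff_norm_sub_tendsto_zero]
  have hlim : Tendsto (fun t : ℝ≥0 => (1 - ε) ^ ⌊t⌋₊ * 2) atTop (𝓝 0) := by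
    have := ((tendsto_pow_atTop_nhds_zero_of_lt_one (sub_nonneg.2 hε1)
      (sub_lt_self 1 hε0)).comp (tendsto_nat_floor_atTop (α := ℝ≥0))).mul_const 2
    simpa using this
  refine squeeze_zero (fun _ => norm_nonneg _) (fun t => ?_) hlim
  -- The bound in `hk` is uniform in the remainder `r`, so the fractional part of `t` plays no role.
  have h := hk ⌊t⌋₊ (t - ⌊t⌋₊)
  rw [tsub_add_cancel_of_le (Nat.floor_le (zero_le (a := t)))] at h
  exact (Finset.single_le_sum (f := fun b => |p t a b - π b|)
    (fun _ _ => abs_nonneg _) (Finset.mem_univ b)).trans h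

theorem stationary_unique (hp : IsTransitionFunction lam p) {π ν : S → ℝ}
    (hπ : π ∈ stdSimplex ℝ S) (hst : IsStationaryFor p π) (hpos : ∀ a b, 0 < p 1 a b)
    (hν : ν ∈ stdSimplex ℝ S) (hνst : IsStationaryFor p ν) : ν = π := by
  funext b
  have h := tendsto_finsetSum Finset.univ fun a _ =>
    (hp.tendsto_stationary hπ hst hpos a b).const_mul (ν a)
  simp only [hνst _ b, ← Finset.sum_mul, hν.2, one_mul] at h
  exact tendsto_nhds_unique tendsto_const_nhds h

end IsTransitionFunction

/-! ### Existence of a reversible transition function. -/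

section Existence

variable {S : Type*} [Fintype S] [DecidableEq S]

open scoped Matrix.Norms.Operator in
/-- The entries of the matrix exponential `t ↦ exp (t • R)`. -/
theorem exists_matrix_exp (R : Matrix S S ℝ) : ∃ E : ℝ → Matrix S S ℝ,
    (∀ t a b, HasSum (fun k : ℕ => t ^ k / k.factorial * (R ^ k) a b) (E t a b)) ∧
    E 0 = 1 ∧ (∀ s t, E (s + t) = E s * E t) ∧
    ∀ a b, HasDerivAt (fun t => E t a b) (R a b) 0 := by
  have hentry : ∀ a b, ∃ L : Matrix S S ℝ →L[ℝ] ℝ, ∀ M, L M = M a b := fun a b =>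
    ⟨LinearMap.toContinuousLinearMap
      { toFun := fun M => M a b, map_add' := fun _ _ => rfl, map_smul' := fun _ _ => rfl },
      fun _ => rfl⟩
  refine ⟨fun t => NormedSpace.exp (t • R), fun t a b => ?_, ?_, fun s t => ?_, fun a b => ?_⟩
  · obtain ⟨L, hL⟩ := hentry a b
    have h := (NormedSpace.exp_series_hasSum_exp' (𝕂 := ℝ) (t • R)).mapL L
    simp only [hL] at h
    refine h.congr_fun fun k => ?_
    rw [smul_pow, Matrix.smul_apply, Matrix.smul_apply, smul_eq_mul, smul_eq_mul]
    ring
  · simp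
  · change NormedSpace.exp ((s + t) • R) = NormedSpace.exp (s • R) * NormedSpace.exp (t • R)
    rw [add_smul]
    exact NormedSpace.exp_add_of_commute (((Commute.refl R).smul_left s).smul_right t)
  · obtain ⟨L, hL⟩ := hentry a b
    have h := L.hasFDerivAt.comp_hasDerivAt (0 : ℝ) (hasDerivAt_exp_smul_const (𝕂 := ℝ) R (0 : ℝ))
    rw [zero_smul, NormedSpace.exp_zero, one_mul] at h
    rw [← hL R]
    exact h.congr_of_eventuallyEq (Eventually.of_forall fun t => (hL _).symm)

theorem pow_nonneg_sum_one_reversible {R : Matrix S S ℝ} {π : S → ℝ} (h0 : ∀ a b, 0 ≤ R a b)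
    (h1 : ∀ a, ∑ b, R a b = 1) (hrev : ∀ a b, π a * R a b = π b * R b a) (k : ℕ) :
    (∀ a b, 0 ≤ (R ^ k) a b) ∧ (∀ a, ∑ b, (R ^ k) a b = 1) ∧
      ∀ a b, π a * (R ^ k) a b = π b * (R ^ k) b a := by
  induction k with
  | zero =>
    refine ⟨fun a b => ?_, fun a => ?_, fun a b => ?_⟩
    · rw [pow_zero, Matrix.one_apply]
      split_ifs <;> norm_num
    · simp [Matrix.one_apply]
    · by_cases hab : a = b
      · rw [hab]
      · simp [hab, Ne.symm hab]
  | succ k ih =>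
    obtain ⟨ih0, ih1, ihrev⟩ := ih
    refine ⟨fun a b => ?_, fun a => ?_, fun a b => ?_⟩
    · rw [pow_succ, Matrix.mul_apply]
      exact Finset.sum_nonneg fun c _ => mul_nonneg (ih0 _ _) (h0 _ _)
    · simp only [pow_succ, Matrix.mul_apply]
      rw [Finset.sum_comm]
      simp only [← Finset.mul_sum, h1, mul_one, ih1]
    · rw [pow_succ, Matrix.mul_apply, ← pow_succ, pow_succ', Matrix.mul_apply, Finset.mul_sum,
        Finset.mul_sum]
      refine Finset.sum_congr rfl fun c _ => ?_
      rw [← mul_assoc, ihrev, mul_right_comm, hrev]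
      ring

/-- Uniformisation: bounded rates are a multiple of a stochastic matrix minus the identity. -/
theorem exists_stochastic_matrix {lam : S → S → ℝ} {π : S → ℝ} (h0 : ∀ a b, 0 ≤ lam a b)
    (hrev : ∀ a b, π a * lam a b = π b * lam b a) :
    ∃ (c : ℝ) (R : Matrix S S ℝ), 0 < c ∧ (∀ a b, 0 ≤ R a b) ∧ (∀ a, ∑ b, R a b = 1) ∧
      (∀ a b, π a * R a b = π b * R b a) ∧ ∀ a b, a ≠ b → c * R a b = lam a b := by
  -- The sum dominates every exit rate, which makes the diagonal of `R` nonnegative; the summand 1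
  -- keeps `c` positive when all rates vanish.
  set c : ℝ := 1 + ∑ a, ∑ b, lam a b
  have hs : 0 ≤ ∑ a, ∑ b, lam a b :=
    Finset.sum_nonneg fun a _ => Finset.sum_nonneg fun b _ => h0 a b
  have hc : 0 < c := by linarith
  have hle : ∀ a, ∑ b ∈ Finset.univ.erase a, lam a b ≤ c := fun a => by
    have h1 : ∑ b ∈ Finset.univ.erase a, lam a b ≤ ∑ b, lam a b :=
      Finset.sum_le_sum_of_subset_of_nonneg (Finset.erase_subset _ _) fun b _ _ => h0 a b
    have h2 : ∑ b, lam a b ≤ ∑ a, ∑ b, lam a b :=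
      Finset.single_le_sum (f := fun a => ∑ b, lam a b)
        (fun a _ => Finset.sum_nonneg fun b _ => h0 a b) (Finset.mem_univ a)
    linarith
  refine ⟨c, fun a b => if a = b then 1 - (∑ x ∈ Finset.univ.erase a, lam a x) / c
    else lam a b / c, hc, fun a b => ?_, fun a => ?_, fun a b => ?_, fun a b hab => ?_⟩
  · dsimp only
    split_ifs
    · exact sub_nonneg.2 ((div_le_one hc).2 (hle a))
    · exact div_nonneg (h0 _ _) hc.le
  · dsimp only
    rw [← Finset.add_sum_erase _ _ (Finset.mem_univ a), if_pos rfl, Finset.sum_div,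
      sub_add_eq_add_sub, sub_eq_iff_eq_add, add_right_inj]
    exact Finset.sum_congr rfl fun b hb => if_neg (Finset.ne_of_mem_erase hb).symm
  · by_cases hab : a = b
    · rw [hab]
    · simp only [if_neg hab, if_neg (Ne.symm hab), ← mul_div_assoc, hrev a b]
  · simp only [if_neg hab]
    exact mul_div_cancel₀ _ hc.ne'

/-- The solution is `exp (-c t) * exp (c t R)` with `R` stochastic. Since `R`, unlike the generator,
has nonnegative entries, positivity, row sums and reversibility can be read off the exponential
series term by term. -/
theorem exists_isTransitionFunction {lam : S → S → ℝ} {π : S → ℝ} (h0 : ∀ a b, 0 ≤ lam a b)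
    (hrev : ∀ a b, π a * lam a b = π b * lam b a) :
    ∃ p, IsTransitionFunction lam p ∧ ∀ t a b, π a * p t a b = π b * p t b a := by
  obtain ⟨c, R, hc, hR0, hR1, hRrev, hlam⟩ := exists_stochastic_matrix h0 hrev
  obtain ⟨E, hE, hE0, hEadd, hEderiv⟩ := exists_matrix_exp R
  have hpow := pow_nonneg_sum_one_reversible hR0 hR1 hRrev
  have hEsum : ∀ t a, ∑ b, E t a b = Real.exp t := fun t a => by
    have h1 := hasSum_sum (s := Finset.univ) fun b _ => hE t a b
    simp only [← Finset.mul_sum, (hpow _).2.1, mul_one] at h1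
    rw [Real.exp_eq_exp_ℝ]
    exact h1.unique (NormedSpace.expSeries_div_hasSum_exp t)
  refine ⟨fun t a b => Real.exp (-(c * t)) * E (c * t) a b, ⟨fun t a b => ?_, fun t a => ?_,
    fun a => ?_, fun a b hab => ?_, fun s t a b => ?_, fun a b hab => ?_⟩, fun t a b => ?_⟩
  · refine mul_nonneg (Real.exp_pos _).le ((hE _ a b).nonneg fun k => ?_)
    exact mul_nonneg (by positivity) ((hpow k).1 a b)
  · rw [← Finset.mul_sum, hEsum, ← Real.exp_add, neg_add_cancel, Real.exp_zero]
  · simp [hE0]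
  · simp [hE0, hab]
  · rw [NNReal.coe_add, mul_add, hEadd, neg_add, Real.exp_add, Matrix.mul_apply, Finset.mul_sum]
    exact Finset.sum_congr rfl fun d _ => by ring
  · have hd : HasDerivAt (fun t : ℝ => E (c * t) a b) (R a b * c) 0 := by
      have hi : HasDerivAt (fun t : ℝ => c * t) c 0 := by
        simpa using (hasDerivAt_id (0 : ℝ)).const_mul c
      have h : HasDerivAt (fun t => E t a b) (R a b) (c * 0) := by simpa using hEderiv a b
      exact h.comp (0 : ℝ) hi
    have he : Tendsto (fun t : ℝ => Real.exp (-(c * t))) (𝓝 0) (𝓝 1) :=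
      Continuous.tendsto' (by fun_prop) _ _ (by simp)
    have hcoe : Tendsto (fun h : ℝ≥0 => (h : ℝ)) (𝓝[>] 0) (𝓝[≠] 0) :=
      tendsto_nhdsWithin_iff.2 ⟨IsTransitionFunction.tendsto_coe_nhdsGT_zero, by
        filter_upwards [self_mem_nhdsWithin] with h hh
        exact NNReal.coe_ne_zero.2 (ne_of_gt hh)⟩
    have h := ((he.mono_left nhdsWithin_le_nhds).mul (hasDerivAt_iff_tendsto_slope.1 hd)).comp hcoe
    rw [one_mul, mul_comm, hlam a b hab] at h
    refine h.congr fun t => ?_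
    simp [slope_def_field, hE0, hab, mul_div_assoc]
  · have h1 := (hE (c * t) a b).mul_left (π a)
    have h2 := (hE (c * t) b a).mul_left (π b)
    have h3 : π a * E (c * t) a b = π b * E (c * t) b a := by
      refine h1.unique (h2.congr_fun fun k => ?_)
      rw [mul_left_comm, (hpow k).2.2, mul_left_comm]
    rw [mul_left_comm, h3, mul_left_comm]

end Existence

/-! ### From transition functions to processes. -/

namespace IsMarkovJumpProcess

variable {S : Type*} [Fintype S] {lam : S → S → ℝ} {Ω : Type*} [MeasurableSpace Ω]
  {μ : Measure Ω} {Z : ℝ≥0 → Ω → S}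

theorem exists_transition (h : IsMarkovJumpProcess lam μ Z) :
    ∃ p, IsTransitionFunction lam p ∧ ∀ s t, s ≤ t → ∀ a b, μ {ω | Z s ω = a} ≠ 0 →
      (μ[|{ω | Z s ω = a}]).real {ω | Z t ω = b} = p (t - s) a b := by
  obtain ⟨p, hp, hm⟩ := h.markov
  refine ⟨p, hp, fun s t hst a b ha => ?_⟩
  have := hm s t hst ∅ (by simp) (fun _ => a) a b
  simpa [ha] using this

theorem law_eq [IsFiniteMeasure μ] (h : IsMarkovJumpProcess lam μ Z) {p : ℝ≥0 → S → S → ℝ}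
    (hp : ∀ s t, s ≤ t → ∀ a b, μ {ω | Z s ω = a} ≠ 0 →
      (μ[|{ω | Z s ω = a}]).real {ω | Z t ω = b} = p (t - s) a b) (t : ℝ≥0) (b : S) :
    μ.real {ω | Z t ω = b} = ∑ a, μ.real {ω | Z 0 ω = a} * p t a b := by
  have hunion : {ω | Z t ω = b} = ⋃ a ∈ Finset.univ, ({ω | Z 0 ω = a} ∩ {ω | Z t ω = b}) := by
    ext ω
    simp
  rw [hunion, measureReal_biUnion_finset]
  · refine Finset.sum_congr rfl fun a _ => ?_
    -- The Markov property says nothing about null initial states, but these contribute zero to both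
    -- sides.
    by_cases ha : μ {ω | Z 0 ω = a} = 0
    · rw [measureReal_def, measureReal_def, ha, measure_mono_null Set.inter_subset_left ha]
      simp
    · have h1 := hp 0 t (zero_le (a := t)) a b ha
      rw [tsub_zero] at h1
      rw [← h1, measureReal_def, measureReal_def, measureReal_def,
        cond_apply (h.measurable 0 a), ENNReal.toReal_mul, ENNReal.toReal_inv,
        mul_inv_cancel_left₀ (ENNReal.toReal_ne_zero.2 ⟨ha, measure_ne_top _ _⟩)]
  · intro a _ a' _ haa'
    refine Set.disjoint_left.2 fun ω hω hω' => haa' ?_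
    exact hω.1.symm.trans hω'.1
  · exact fun a _ => (h.measurable 0 a).inter (h.measurable t b)

theorem law_mem_stdSimplex [IsProbabilityMeasure μ] (h : IsMarkovJumpProcess lam μ Z)
    (t : ℝ≥0) : (fun a => μ.real {ω | Z t ω = a}) ∈ stdSimplex ℝ S := by
  refine ⟨fun a => measureReal_nonneg, ?_⟩
  have hunion : (Set.univ : Set Ω) = ⋃ a ∈ Finset.univ, {ω | Z t ω = a} := by
    ext ω
    simp
  rw [← probReal_univ (μ := μ), hunion, measureReal_biUnion_finset]
  · intro a _ a' _ haa'
    exact Set.disjoint_left.2 fun ω hω hω' => haa' (Eq.symm hω |>.trans hω')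
  · exact fun a _ => h.measurable t a

end IsMarkovJumpProcess

theorem mainTheorem2 (n : ℕ)
    (g : ℝ → ℝ) (hg : ∀ t, 0 < t → g t = t * g (1 / t)) (hg_pos : ∀ t, 0 < t → 0 < g t)
    (π : MEC n → ℝ) (hπ : π ∈ stdSimplex ℝ (MEC n)) (hπ_pos : ∀ γ, 0 < π γ) :
    (∃! p, IsTransitionFunction (MEC.zanellaRate g π) p) ∧
    (∀ p, IsTransitionFunction (MEC.zanellaRate g π) p →
      (∀ t, 0 < t → ∀ η γ, 0 < p t η γ) ∧
      (∀ t η γ, π η * p t η γ = π γ * p t γ η) ∧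
      (∀ ν ∈ stdSimplex ℝ (MEC n), IsStationaryFor p ν ↔ ν = π) ∧
      (∀ η γ, Tendsto (fun t => p t η γ) atTop (𝓝 (π γ)))) ∧
    (∀ (Ω : Type*) [MeasurableSpace Ω] (μ : Measure Ω) [IsProbabilityMeasure μ]
      (Z : ℝ≥0 → Ω → MEC n), IsMarkovJumpProcess (MEC.zanellaRate g π) μ Z →
      (∀ s t, s < t → ∀ η γ, μ {ω | Z s ω = η} ≠ 0 →
        0 < (μ[|{ω | Z s ω = η}]).real {ω | Z t ω = γ}) ∧
      ((∀ t γ, μ.real {ω | Z t ω = γ} = μ.real {ω | Z 0 ω = γ}) ↔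
        ∀ γ, μ.real {ω | Z 0 ω = γ} = π γ) ∧
      (∀ s η γ, μ {ω | Z s ω = η} ≠ 0 →
        Tendsto (fun t => (μ[|{ω | Z s ω = η}]).real {ω | Z t ω = γ}) atTop (𝓝 (π γ)))) := by
  classical
  obtain ⟨p₀, hp₀, hrev₀⟩ := exists_isTransitionFunction
    (MEC.zanellaRate_nonneg (n := n) hg_pos hπ_pos) (MEC.zanellaRate_reversible hg hπ_pos)
  have hchain : ∀ p, IsTransitionFunction (MEC.zanellaRate g π) p →
      (∀ t, 0 < t → ∀ η γ, 0 < p t η γ) ∧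
      (∀ t η γ, π η * p t η γ = π γ * p t γ η) ∧
      (∀ ν ∈ stdSimplex ℝ (MEC n), IsStationaryFor p ν ↔ ν = π) ∧
      (∀ η γ, Tendsto (fun t => p t η γ) atTop (𝓝 (π γ))) := by
    intro p hp
    have hpos : ∀ t, 0 < t → ∀ η γ, 0 < p t η γ := fun t ht η γ =>
      hp.pos_of_reflTransGen (Relation.ReflTransGen.mono
        (fun _ _ h => h.zanellaRate_pos hg_pos hπ_pos) η γ (MEC.reflTransGen_isLocalMove η γ)) ht
    have hrev : ∀ t η γ, π η * p t η γ = π γ * p t γ η := by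
      -- Reversibility is known for the constructed solution only and passes to `p` by uniqueness.
      rw [hp.unique hp₀]
      exact hrev₀
    have hst : IsStationaryFor p π := fun t b => by
      simp only [hrev t _ b, ← Finset.mul_sum, hp.sum_eq_one, mul_one]
    exact ⟨hpos, hrev, fun ν hν => ⟨hp.stationary_unique hπ hst (hpos 1 one_pos) hν,
      fun h => h ▸ hst⟩, hp.tendsto_stationary hπ hst (hpos 1 one_pos)⟩
  refine ⟨⟨p₀, hp₀, fun q hq => hq.unique hp₀⟩, hchain, ?_⟩
  intro Ω _ μ _ Z hZ
  obtain ⟨p, hp, hcond⟩ := hZ.exists_transition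
  obtain ⟨hpos, -, hstat, hlim⟩ := hchain p hp
  refine ⟨fun s t hst η γ hη => ?_, ⟨fun h => ?_, fun h t γ => ?_⟩, fun s η γ hη => ?_⟩
  · rw [hcond s t hst.le η γ hη]
    exact hpos _ (tsub_pos_of_lt hst) η γ
  · refine congrFun ((hstat _ (hZ.law_mem_stdSimplex 0)).1 fun t b => ?_)
    rw [← hZ.law_eq hcond, h]
  · rw [hZ.law_eq hcond]
    simp only [h]
    exact (hstat π hπ).2 rfl t γ
  · have hsub : Tendsto (fun t : ℝ≥0 => t - s) atTop atTop :=
      tendsto_atTop.2 fun b => (eventually_ge_atTop (b + s)).mono fun t ht =>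
        le_tsub_of_add_le_right ht
    refine ((hlim η γ).comp hsub).congr' ?_
    filter_upwards [eventually_ge_atTop s] with t ht
    exact (hcond s t ht η γ hη).symm
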